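/- Let $K$ be a field, let $m,n$ be positive integers, let $X=(x_{ij})$ be the $m\times n$ matrix of indeterminates over $K$, and let $I_2(X)$ be the ideal of $K[x_{ij} : 1\le i\le m,\ 1\le j\le n]$ generated by all $2$-minors of $X$. For an integer $s$ with $2\le s\le \min(m,n)$ and sequences $I=(i_1,\dots,i_s)$ of distinct elements of $\{1,\dots,m\}$ and $J=(j_1,\dots,j_s)$ of distinct elements of $\{1,\dots,n\}$, put $$F_{I,J}=x_{i_1j_1}x_{i_2j_2}\cdots x_{i_sj_s}-x_{i_1j_2}x_{i_2j_3}\cdots x_{i_{s-1}j_s}x_{i_sj_1}.$$ Then the set of all binomials $F_{I,J}$ (over all such $s$, $I$, $J$) is a universal Gröbner basis of $I_2(X)$. That is, it is a finite set of nonzero elements of $I_2(X)$ and, for every term order on the monomials of $K[x_{ij}]$, the initial monomials of the $F_{I,J}$ generate the initial ideal $\operatorname{in}(I_2(X))=(\operatorname{in}(f) : f\in I_2(X)\setminus\{0\})$. -/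

import Mathlib

universe u v

noncomputable section

namespace DetGroebner

/-- The initial monomial `in(f)` of `f` with respect to the term order `ord`: the largest monomial
occurring in `f`, with coefficient `1` (meaningful for `f ≠ 0`). -/
def initialMonomial {σ K : Type*} [CommSemiring K] (ord : MonomialOrder σ)
    (f : MvPolynomial σ K) : MvPolynomial σ K :=
  MvPolynomial.monomial (ord.degree f) 1

/-- The initial ideal `in(I)`, generated by the initial monomials of the nonzero elements
of `I`. -/
def initialIdeal {σ K : Type*} [Field K] (ord : MonomialOrder σ)
    (I : Ideal (MvPolynomial σ K)) : Ideal (MvPolynomial σ K) :=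
  Ideal.span {g | ∃ f ∈ I, f ≠ 0 ∧ initialMonomial ord f = g}

/-- `G` is a Gröbner basis of `I` with respect to `ord`: a finite set of nonzero elements of `I`
whose initial monomials generate the initial ideal of `I`. -/
structure IsGroebnerBasis {σ K : Type*} [Field K] (ord : MonomialOrder σ)
    (G : Set (MvPolynomial σ K)) (I : Ideal (MvPolynomial σ K)) : Prop where
  finite : G.Finite
  subset : ∀ g ∈ G, g ∈ I
  ne_zero : ∀ g ∈ G, g ≠ 0
  span_eq : Ideal.span (initialMonomial ord '' G) = initialIdeal ord I

/-- `G` is a universal Gröbner basis of `I`: a Gröbner basis with respect to every term order.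
(A term order is a structure on the type `σ →₀ ℕ` of exponents, so letting the carrier of the
order range over the universe of `σ` covers all term orders.) -/
def IsUniversalGroebnerBasis {σ : Type u} {K : Type v} [Field K]
    (G : Set (MvPolynomial σ K)) (I : Ideal (MvPolynomial σ K)) : Prop :=
  ∀ ord : MonomialOrder.{u, u} σ, IsGroebnerBasis ord G I

/-- The determinantal ideal `I_t(A)`, generated by all `t`-minors of the `m × n` matrix `A`. -/
def determinantalIdeal {R : Type*} [CommRing R] {m n : ℕ} (t : ℕ)
    (A : Matrix (Fin m) (Fin n) R) : Ideal R :=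
  Ideal.span {d | ∃ (r : Fin t ↪o Fin m) (c : Fin t ↪o Fin n), d = (A.submatrix r c).det}

/-- The binomial `F_{I,J} = x_{i₁j₁} x_{i₂j₂} ⋯ x_{iₛjₛ} - x_{i₁j₂} x_{i₂j₃} ⋯ x_{iₛj₁}` attached to
sequences `I = i₁,…,iₛ` and `J = j₁,…,jₛ`. Here `finRotate s` is the cyclic shift `k ↦ k + 1`. -/
def cycleBinomial (K : Type*) [Field K] {m n s : ℕ} (I : Fin s → Fin m) (J : Fin s → Fin n) :
    MvPolynomial (Fin m × Fin n) K :=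
  ∏ k, MvPolynomial.X (I k, J k) - ∏ k, MvPolynomial.X (I k, J (finRotate s k))

/-- The set of all `F_{I,J}`, where `I` and `J` are sequences of the same length `s ≥ 2`, each with
distinct entries (so `s ≤ m` and `s ≤ n`). -/
def cycleBinomials (K : Type*) [Field K] (m n : ℕ) : Set (MvPolynomial (Fin m × Fin n) K) :=
  {F | ∃ (s : ℕ) (I : Fin s → Fin m) (J : Fin s → Fin n),
    2 ≤ s ∧ Function.Injective I ∧ Function.Injective J ∧ F = cycleBinomial K I J}

end DetGroebner

end

/-!
The Segre map `x_{ij} ↦ y_i z_j` kills the `2`-minors, and it sends two monomials to the same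
monomial exactly when their exponent matrices have the same row and column sums. So if `f` lies in
the ideal, its initial exponent `a` shares these margins with an exponent `b ≺ a` of `f`. Since
`a` and `b` have equal margins, each row or column containing an entry with `b < a` contains one
with `a < b` and conversely; alternating between such entries closes up to a cycle whose binomial
`x^u - x^v` satisfies `u ≤ a` and `v ≤ b`. Either `v ≺ u`, and the initial monomial of this
binomial divides `x^a`, or the argument can be repeated with `b - v ≺ a - u`.
-/

namespace DetGroebner

open MvPolynomial

open scoped MonomialOrder

section Preliminaries

theorem exists_mem_periodicPts_of_mapsTo {α : Type*} {f : α → α} {S : Set α} (hfin : S.Finite)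
    (hne : S.Nonempty) (hf : S.MapsTo f S) : ∃ x ∈ S, x ∈ Function.periodicPts f := by
  obtain ⟨x₀, hx₀⟩ := hne
  obtain ⟨k, l, hkl, heq⟩ :=
    hfin.exists_lt_map_eq_of_forall_mem (f := fun k : ℕ => f^[k] x₀) fun k => hf.iterate k hx₀
  refine ⟨f^[k] x₀, hf.iterate k hx₀, Function.mk_mem_periodicPts (Nat.sub_pos_of_lt hkl) ?_⟩
  rw [Function.IsPeriodicPt, Function.IsFixedPt, ← Function.iterate_add_apply,
    Nat.sub_add_cancel hkl.le]
  exact heq.symm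

theorem iterate_finRotate_minimalPeriod {α : Type*} (f : α → α) (x : α)
    (k : Fin (Function.minimalPeriod f x)) :
    f^[finRotate _ k] x = f (f^[k] x) := by
  have hval : (finRotate _ k : ℕ) = (k + 1) % Function.minimalPeriod f x := by
    have := k.neZero
    rw [finRotate_apply, Fin.val_add, Fin.val_one', Nat.add_mod_mod]
  rw [hval, Function.iterate_mod_minimalPeriod_eq, Function.iterate_succ_apply']

theorem exists_injective_finRotate_eq_of_mapsTo {α : Type*} {f : α → α} {S : Set α}
    (hfin : S.Finite) (hne : S.Nonempty) (hf : S.MapsTo f S) :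
    ∃ (s : ℕ) (I : Fin s → α), 0 < s ∧ Function.Injective I ∧ (∀ k, I k ∈ S) ∧
      ∀ k, I (finRotate s k) = f (I k) := by
  obtain ⟨x, hx, hper⟩ := exists_mem_periodicPts_of_mapsTo hfin hne hf
  exact ⟨Function.minimalPeriod f x, fun k => f^[k] x,
    Function.minimalPeriod_pos_of_mem_periodicPts hper,
    fun k l h => Fin.ext ((Function.iterate_eq_iterate_iff_of_lt_minimalPeriod k.2 l.2).1 h),
    fun k => hf.iterate k hx, iterate_finRotate_minimalPeriod f x⟩

theorem finRotate_ne_self {s : ℕ} (hs : 2 ≤ s) (k : Fin s) : finRotate s k ≠ k := by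
  rw [← Equiv.Perm.mem_support, support_finRotate_of_le hs]
  exact Finset.mem_univ k

theorem exists_lt_of_sum_eq_of_lt {ι M : Type*} [Fintype ι] [AddCommMonoid M] [LinearOrder M]
    [IsOrderedCancelAddMonoid M] {f g : ι → M} (h : ∑ i, f i = ∑ i, g i) {i : ι}
    (hi : f i < g i) : ∃ j, g j < f j := by
  by_contra! hle
  exact (Finset.sum_lt_sum (fun j _ => hle j) ⟨i, Finset.mem_univ i, hi⟩).ne h

theorem sum_single_one_le_of_injective {ι σ : Type*} [Fintype ι] {p : ι → σ}
    (hp : Function.Injective p) {a : σ →₀ ℕ} (h : ∀ k, 0 < a (p k)) :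
    ∑ k, Finsupp.single (p k) 1 ≤ a := by
  classical
  intro x
  simp only [Finsupp.finsetSum_apply, Finsupp.single_apply]
  by_cases hx : ∃ k, p k = x
  · obtain ⟨k, rfl⟩ := hx
    rw [Finset.sum_eq_single_of_mem k (Finset.mem_univ k) fun l _ hl => if_neg (hp.ne hl),
      if_pos rfl]
    exact h k
  · push Not at hx
    simp only [hx, if_false, Finset.sum_const_zero, zero_le]

theorem prod_perm_eq_prod_diag {ι M : Type*} [Fintype ι] [CommMonoid M] {f : ι → ι → M}
    (hf : ∀ i j k l, f i j * f k l = f i l * f k j) (e : Equiv.Perm ι) :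
    ∏ k, f k (e k) = ∏ k, f k k := by
  classical
  induction e using Equiv.Perm.swap_induction_on' with
  | one => rfl
  | mul_swap e x y hxy ih =>
    rw [← ih]
    have hy : y ∈ Finset.univ.erase x := Finset.mem_erase.2 ⟨hxy.symm, Finset.mem_univ y⟩
    have hrest : ∏ k ∈ (Finset.univ.erase x).erase y, f k (e (Equiv.swap x y k)) =
        ∏ k ∈ (Finset.univ.erase x).erase y, f k (e k) := by
      refine Finset.prod_congr rfl fun k hk => ?_
      obtain ⟨hky, hkx, -⟩ := by simpa only [Finset.mem_erase] using hk
      rw [Equiv.swap_apply_of_ne_of_ne hkx hky]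
    simp only [Equiv.Perm.mul_apply, ← Finset.mul_prod_erase _ _ (Finset.mem_univ x),
      ← Finset.mul_prod_erase _ _ hy, hrest,
      Equiv.swap_apply_left, Equiv.swap_apply_right, ← mul_assoc]
    rw [hf]

end Preliminaries

/-- A cycle `i₁, j₂, i₂, j₃, …, iₛ, j₁, i₁` in the complete bipartite graph on `α ⊔ β`, recorded by
the sequences `row = (i₁, …, iₛ)` and `col = (j₁, …, jₛ)`; these are the index sequences of the
binomials `F_{I,J}`. A single edge traversed back and forth (`s = 1`) does not count as a cycle. -/
structure BipartiteCycle (α β : Type*) where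
  length : ℕ
  row : Fin length → α
  col : Fin length → β
  two_le_length : 2 ≤ length
  row_injective : Function.Injective row
  col_injective : Function.Injective col

theorem exists_alternating_cycle {α β : Type*} [Finite α] {P N : α → β → Prop}
    (hne : ∃ i j, P i j) (hrow : ∀ i, (∃ j, P i j) → ∃ j, N i j)
    (hcol : ∀ j, (∃ i, N i j) → ∃ i, P i j) (hdisj : ∀ i j, P i j → ¬ N i j) :
    ∃ c : BipartiteCycle α β, (∀ k, P (c.row k) (c.col k)) ∧
      ∀ k, N (c.row k) (c.col (finRotate c.length k)) := by
  obtain ⟨i₀, j₀, h₀⟩ := hne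
  have : Nonempty α := ⟨i₀⟩
  have : Nonempty β := ⟨j₀⟩
  choose! ν hν using hrow
  choose! ρ hρ using hcol
  let D : Set α := {i | ∃ j, P i j}
  have hmaps : D.MapsTo (fun i => ρ (ν i)) D := fun i hi => ⟨ν i, hρ _ ⟨i, hν i hi⟩⟩
  obtain ⟨s, I, hpos, hI, hmem, hrot⟩ :=
    exists_injective_finRotate_eq_of_mapsTo D.toFinite ⟨i₀, j₀, h₀⟩ hmaps
  let J : Fin s → β := fun k => ν (I ((finRotate s).symm k))
  have hρJ : ∀ k, ρ (J k) = I k := fun k => by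
    simpa only [Equiv.apply_symm_apply] using (hrot ((finRotate s).symm k)).symm
  have hJ : Function.Injective J := fun k l h => hI (by rw [← hρJ, h, hρJ])
  have hNI : ∀ k, N (I k) (ν (I k)) := fun k => hν _ (hmem k)
  have hN : ∀ k, N (I k) (J (finRotate s k)) := fun k => by
    simpa only [J, Equiv.symm_apply_apply] using hNI k
  have hP : ∀ k, P (I k) (J k) := fun k => by
    simpa only [hρJ] using hρ (J k) ⟨_, hNI _⟩
  have hs : 2 ≤ s := by
    by_contra hlt
    have : Subsingleton (Fin s) := Fin.subsingleton_iff_le_one.2 (by omega)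
    refine hdisj _ _ (hP ⟨0, hpos⟩) ?_
    simpa only [Subsingleton.elim (finRotate s _) ⟨0, hpos⟩] using hN ⟨0, hpos⟩
  exact ⟨⟨s, I, J, hs, hI, hJ⟩, hP, hN⟩

section Margins

variable {α β : Type*}

/-- The row sums and column sums of an exponent matrix `a`, as an exponent in the variables
indexed by rows (`Sum.inl`) and columns (`Sum.inr`): the exponent of the image of `x^a` under the
Segre map. -/
noncomputable def margins : (α × β →₀ ℕ) →+ (α ⊕ β →₀ ℕ) :=
  Finsupp.mapDomain.addMonoidHom (Sum.inl ∘ Prod.fst) +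
    Finsupp.mapDomain.addMonoidHom (Sum.inr ∘ Prod.snd)

theorem margins_apply (a : α × β →₀ ℕ) :
    margins a = a.mapDomain (Sum.inl ∘ Prod.fst) + a.mapDomain (Sum.inr ∘ Prod.snd) :=
  rfl

theorem margins_single (p : α × β) (c : ℕ) :
    margins (Finsupp.single p c) =
      Finsupp.single (Sum.inl p.1) c + Finsupp.single (Sum.inr p.2) c := by
  simp only [margins_apply, Finsupp.mapDomain_single, Function.comp_apply]

theorem margins_inl [Fintype β] (a : α × β →₀ ℕ) (i : α) :
    margins a (Sum.inl i) = ∑ j, a (i, j) := by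
  classical
  induction a using Finsupp.induction_linear with
  | zero => simp
  | add a b ha hb => simp [ha, hb, Finset.sum_add_distrib]
  | single p c => simp [margins_single, Finsupp.single_apply, Prod.ext_iff, ite_and]

theorem margins_inr [Fintype α] (a : α × β →₀ ℕ) (j : β) :
    margins a (Sum.inr j) = ∑ i, a (i, j) := by
  classical
  induction a using Finsupp.induction_linear with
  | zero => simp
  | add a b ha hb => simp [ha, hb, Finset.sum_add_distrib]
  | single p c => simp [margins_single, Finsupp.single_apply, Prod.ext_iff, ite_and]

end Margins

namespace BipartiteCycle

variable {α β : Type*} (c : BipartiteCycle α β)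

/-- The exponent of the positive term of the binomial `F_{I,J}` attached to a cycle. -/
noncomputable def posExponent : α × β →₀ ℕ :=
  ∑ k, Finsupp.single (c.row k, c.col k) 1

/-- The exponent of the negative term of the binomial `F_{I,J}` attached to a cycle. -/
noncomputable def negExponent : α × β →₀ ℕ :=
  ∑ k, Finsupp.single (c.row k, c.col (finRotate c.length k)) 1

variable {c} in
theorem posExponent_le {a : α × β →₀ ℕ} (h : ∀ k, 0 < a (c.row k, c.col k)) :
    c.posExponent ≤ a :=
  sum_single_one_le_of_injective (fun _ _ hkl => c.row_injective (congrArg Prod.fst hkl)) h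

variable {c} in
theorem negExponent_le {a : α × β →₀ ℕ}
    (h : ∀ k, 0 < a (c.row k, c.col (finRotate c.length k))) : c.negExponent ≤ a :=
  sum_single_one_le_of_injective (fun _ _ hkl => c.row_injective (congrArg Prod.fst hkl)) h

theorem margins_negExponent : margins c.negExponent = margins c.posExponent := by
  simp only [negExponent, posExponent, map_sum, margins_single, Finset.sum_add_distrib]
  rw [Equiv.sum_comp (finRotate c.length) fun k => Finsupp.single (Sum.inr (c.col k)) 1]

theorem posExponent_pos : 0 < c.posExponent := by
  have hdeg : c.posExponent.degree = c.length := by simp [posExponent]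
  have hlen := c.two_le_length
  refine pos_iff_ne_zero.2 fun h => ?_
  rw [h, map_zero] at hdeg
  omega

theorem negExponent_ne_posExponent : c.negExponent ≠ c.posExponent := by
  classical
  let k : Fin c.length := ⟨0, two_pos.trans_le c.two_le_length⟩
  have hpos : c.posExponent (c.row k, c.col k) ≠ 0 := by
    simp [posExponent, Finsupp.finsetSum_apply, Finsupp.single_apply, c.row_injective.eq_iff,
      c.col_injective.eq_iff]
  have hneg : c.negExponent (c.row k, c.col k) = 0 := by
    rw [negExponent, Finsupp.finsetSum_apply]
    refine Finset.sum_eq_zero fun l _ => Finsupp.single_eq_of_ne' fun hl => ?_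
    obtain ⟨hrow, hcol⟩ := Prod.ext_iff.1 hl
    obtain rfl := c.row_injective hrow
    exact finRotate_ne_self c.two_le_length _ (c.col_injective hcol)
  intro h
  exact hpos (h ▸ hneg)

end BipartiteCycle

section Exchange

variable {α β : Type*} [Finite α] [Finite β] {a b : α × β →₀ ℕ}

theorem exists_posExponent_le_negExponent_le (hm : margins a = margins b) (hab : a ≠ b) :
    ∃ c : BipartiteCycle α β, c.posExponent ≤ a ∧ c.negExponent ≤ b := by
  cases nonempty_fintype α
  cases nonempty_fintype β
  have hr : ∀ i, ∑ j, a (i, j) = ∑ j, b (i, j) := fun i => by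
    rw [← margins_inl, hm, margins_inl]
  have hc : ∀ j, ∑ i, a (i, j) = ∑ i, b (i, j) := fun j => by
    rw [← margins_inr, hm, margins_inr]
  have hne : ∃ i j, b (i, j) < a (i, j) := by
    obtain ⟨⟨i, j⟩, hij⟩ := DFunLike.ne_iff.1 hab
    rcases hij.lt_or_gt with h | h
    · exact ⟨i, exists_lt_of_sum_eq_of_lt (hr i) h⟩
    · exact ⟨i, j, h⟩
  obtain ⟨c, hpos, hneg⟩ := exists_alternating_cycle hne
    (N := fun i j => a (i, j) < b (i, j))
    (fun i ⟨_, h⟩ => exists_lt_of_sum_eq_of_lt (hr i).symm h)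
    (fun j ⟨_, h⟩ => exists_lt_of_sum_eq_of_lt (hc j) h)
    (fun _ _ h => h.not_gt)
  exact ⟨c, BipartiteCycle.posExponent_le fun k => (hpos k).pos,
    BipartiteCycle.negExponent_le fun k => (hneg k).pos⟩

theorem exists_posExponent_le_negExponent_lt (ord : MonomialOrder (α × β))
    (hm : margins a = margins b) (hlt : b ≺[ord] a) :
    ∃ c : BipartiteCycle α β, c.posExponent ≤ a ∧ c.negExponent ≺[ord] c.posExponent := by
  induction a using WellFoundedLT.induction generalizing b with
  | ind a ih =>
    obtain ⟨c, hu, hv⟩ := exists_posExponent_le_negExponent_le hm (by rintro rfl; exact hlt.ne rfl)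
    by_cases h : c.negExponent ≺[ord] c.posExponent
    · exact ⟨c, hu, h⟩
    obtain ⟨a', rfl⟩ := exists_add_of_le hu
    obtain ⟨b', rfl⟩ := exists_add_of_le hv
    have hm' : margins a' = margins b' := by
      rwa [map_add, map_add, c.margins_negExponent, add_right_inj] at hm
    have hlt' : b' ≺[ord] a' := by
      rw [map_add, map_add] at hlt
      exact lt_of_not_ge fun hle => (add_le_add (not_lt.1 h) hle).not_gt hlt
    obtain ⟨c', hu', h'⟩ := ih a' (lt_add_of_pos_left a' c.posExponent_pos) hm' hlt'
    exact ⟨c', hu'.trans le_add_self, h'⟩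

end Exchange

section SegreMap

variable {σ τ α β R : Type*} [CommSemiring R]

theorem exists_lt_degree_of_map_eq_zero (ord : MonomialOrder σ) {π : (σ →₀ ℕ) → τ →₀ ℕ}
    {φ : MvPolynomial σ R →ₗ[R] MvPolynomial τ R}
    (hφ : ∀ a r, φ (monomial a r) = monomial (π a) r) {f : MvPolynomial σ R} (hf : f ≠ 0)
    (h : φ f = 0) : ∃ b, b ≺[ord] ord.degree f ∧ π (ord.degree f) = π b := by
  classical
  by_contra! halone
  have hsum : φ f = ∑ d ∈ f.support, monomial (π d) (coeff d f) := by
    conv_lhs => rw [← support_sum_monomial_coeff f]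
    simp only [map_sum, hφ]
  have hmem : ord.degree f ∈ f.support := ord.degree_mem_support hf
  have hcoeff : coeff (π (ord.degree f)) (φ f) = coeff (ord.degree f) f := by
    rw [hsum, coeff_sum, Finset.sum_eq_single_of_mem _ hmem, coeff_monomial, if_pos rfl]
    intro d hd hne
    have hlt : d ≺[ord] ord.degree f := (ord.le_degree hd).lt_of_ne (ord.toSyn.injective.ne hne)
    rw [coeff_monomial, if_neg (halone d hlt).symm]
  rw [h, coeff_zero] at hcoeff
  exact mem_support_iff.1 hmem hcoeff.symm

variable (R α β) in
/-- The parametrization `x_{ij} ↦ y_i z_j` of the matrices of rank at most one, where the `y_i` are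
the variables indexed by `Sum.inl` and the `z_j` those indexed by `Sum.inr`. -/
noncomputable def segreMap : MvPolynomial (α × β) R →ₐ[R] MvPolynomial (α ⊕ β) R :=
  aeval fun p => X (Sum.inl p.1) * X (Sum.inr p.2)

theorem segreMap_monomial (a : α × β →₀ ℕ) (r : R) :
    segreMap α β R (monomial a r) = monomial (margins a) r := by
  rw [segreMap, aeval_monomial, monomial_eq, margins_apply,
    Finsupp.prod_add_index' (fun _ => pow_zero _) (fun _ => pow_add _),
    Finsupp.prod_mapDomain_index (fun _ => pow_zero _) (fun _ => pow_add _),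
    Finsupp.prod_mapDomain_index (fun _ => pow_zero _) (fun _ => pow_add _), ← Finsupp.prod_mul]
  simp only [mul_pow, Function.comp_apply, algebraMap_eq]

end SegreMap

section TwoMinors

variable {R : Type*} [CommRing R] {m n : ℕ}

theorem determinantalIdeal_two_le_iff {A : Matrix (Fin m) (Fin n) R} {𝔞 : Ideal R} :
    determinantalIdeal 2 A ≤ 𝔞 ↔ ∀ i j k l, A i j * A k l - A i l * A k j ∈ 𝔞 := by
  rw [determinantalIdeal, Ideal.span_le]
  constructor
  · intro h i j k l
    wlog hik : i < k generalizing i j k l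
    · rcases (not_lt.1 hik).eq_or_lt with rfl | hki
      · simp [mul_comm]
      · simpa [mul_comm] using this k l i j hki
    wlog hjl : j < l generalizing j l
    · rcases (not_lt.1 hjl).eq_or_lt with rfl | hlj
      · simp
      · simpa using neg_mem (this l j hlj)
    have hr : StrictMono ![i, k] := by simpa [Fin.strictMono_iff_lt_succ] using hik
    have hc : StrictMono ![j, l] := by simpa [Fin.strictMono_iff_lt_succ] using hjl
    refine h ⟨OrderEmbedding.ofStrictMono _ hr, OrderEmbedding.ofStrictMono _ hc, ?_⟩
    rw [Matrix.det_fin_two]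
    simp
  · rintro h _ ⟨r, c, rfl⟩
    rw [Matrix.det_fin_two]
    exact h _ _ _ _

theorem determinantalIdeal_two_le_ker_segreMap :
    determinantalIdeal 2 (Matrix.mvPolynomialX (Fin m) (Fin n) R) ≤
      RingHom.ker (segreMap (Fin m) (Fin n) R) := by
  refine determinantalIdeal_two_le_iff.2 fun i j k l => ?_
  rw [RingHom.mem_ker]
  simp only [segreMap, Matrix.mvPolynomialX_apply, map_sub, map_mul, aeval_X]
  ring

theorem prod_sub_prod_perm_mem_determinantalIdeal_two {ι : Type*} [Fintype ι]
    (A : Matrix (Fin m) (Fin n) R) (I : ι → Fin m) (J : ι → Fin n) (e : Equiv.Perm ι) :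
    ∏ k, A (I k) (J k) - ∏ k, A (I k) (J (e k)) ∈ determinantalIdeal 2 A := by
  rw [← Ideal.Quotient.eq, map_prod, map_prod]
  refine (prod_perm_eq_prod_diag
    (f := fun k l => Ideal.Quotient.mk (determinantalIdeal 2 A) (A (I k) (J l))) ?_ e).symm
  intro i j k l
  rw [← map_mul, ← map_mul, Ideal.Quotient.eq]
  exact determinantalIdeal_two_le_iff.1 le_rfl _ _ _ _

end TwoMinors

section CycleBinomials

variable {K : Type*} [Field K] {m n : ℕ}

theorem cycleBinomials_eq_range :
    cycleBinomials K m n =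
      Set.range fun c : BipartiteCycle (Fin m) (Fin n) => cycleBinomial K c.row c.col := by
  ext F
  constructor
  · rintro ⟨s, I, J, hs, hI, hJ, rfl⟩
    exact ⟨⟨s, I, J, hs, hI, hJ⟩, rfl⟩
  · rintro ⟨c, rfl⟩
    exact ⟨_, _, _, c.two_le_length, c.row_injective, c.col_injective, rfl⟩

theorem cycleBinomials_finite : (cycleBinomials K m n).Finite := by
  refine (Set.finite_range fun p : Σ s : Fin (m + 1), (Fin s → Fin m) × (Fin s → Fin n) =>
    cycleBinomial K p.2.1 p.2.2).subset ?_
  rintro _ ⟨s, I, J, -, hI, -, rfl⟩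
  have hsm : s ≤ m := by simpa using Fintype.card_le_of_injective I hI
  exact ⟨⟨⟨s, Nat.lt_succ_of_le hsm⟩, I, J⟩, rfl⟩

variable (c : BipartiteCycle (Fin m) (Fin n))

theorem cycleBinomial_eq_monomial_sub_monomial :
    cycleBinomial K c.row c.col = monomial c.posExponent 1 - monomial c.negExponent 1 := by
  rw [cycleBinomial, BipartiteCycle.posExponent, BipartiteCycle.negExponent, monomial_sum_one,
    monomial_sum_one]
  rfl

theorem cycleBinomial_mem_determinantalIdeal :
    cycleBinomial K c.row c.col ∈
      determinantalIdeal 2 (Matrix.mvPolynomialX (Fin m) (Fin n) K) :=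
  prod_sub_prod_perm_mem_determinantalIdeal_two _ _ _ _

theorem cycleBinomial_ne_zero : cycleBinomial K c.row c.col ≠ 0 := by
  rw [cycleBinomial_eq_monomial_sub_monomial, sub_ne_zero]
  exact (monomial_left_injective one_ne_zero).ne c.negExponent_ne_posExponent.symm

variable {c} in
theorem degree_cycleBinomial {ord : MonomialOrder (Fin m × Fin n)}
    (h : c.negExponent ≺[ord] c.posExponent) :
    ord.degree (cycleBinomial K c.row c.col) = c.posExponent := by
  classical
  have hdeg (d) : ord.degree (monomial d (1 : K)) = d := by
    rw [ord.degree_monomial, if_neg one_ne_zero]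
  rw [cycleBinomial_eq_monomial_sub_monomial, ord.degree_sub_of_lt, hdeg]
  rwa [hdeg, hdeg]

theorem exists_degree_cycleBinomial_le_degree (ord : MonomialOrder (Fin m × Fin n))
    {f : MvPolynomial (Fin m × Fin n) K} (hf : f ≠ 0)
    (hmem : f ∈ determinantalIdeal 2 (Matrix.mvPolynomialX (Fin m) (Fin n) K)) :
    ∃ c : BipartiteCycle (Fin m) (Fin n),
      ord.degree (cycleBinomial K c.row c.col) ≤ ord.degree f := by
  obtain ⟨b, hlt, hm⟩ := exists_lt_degree_of_map_eq_zero ord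
    (φ := (segreMap (Fin m) (Fin n) K).toLinearMap) segreMap_monomial hf
    (determinantalIdeal_two_le_ker_segreMap hmem)
  obtain ⟨c, hle, hc⟩ := exists_posExponent_le_negExponent_lt ord hm hlt
  exact ⟨c, (degree_cycleBinomial hc).trans_le hle⟩

end CycleBinomials

section GroebnerBasis

variable {σ K : Type*} [Field K] {ord : MonomialOrder σ}

theorem initialMonomial_dvd_of_degree_le {R : Type*} [CommSemiring R] {f g : MvPolynomial σ R}
    (h : ord.degree g ≤ ord.degree f) : initialMonomial ord g ∣ initialMonomial ord f :=
  monomial_dvd_monomial.2 ⟨Or.inr h, one_dvd _⟩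

theorem isGroebnerBasis_of_exists_degree_le {G : Set (MvPolynomial σ K)}
    {𝔞 : Ideal (MvPolynomial σ K)} (hfin : G.Finite) (hsub : ∀ g ∈ G, g ∈ 𝔞)
    (hne : ∀ g ∈ G, g ≠ 0)
    (hdeg : ∀ f ∈ 𝔞, f ≠ 0 → ∃ g ∈ G, ord.degree g ≤ ord.degree f) :
    IsGroebnerBasis ord G 𝔞 := by
  refine ⟨hfin, hsub, hne, le_antisymm (Ideal.span_mono ?_) (Ideal.span_le.2 ?_)⟩
  · rintro _ ⟨g, hg, rfl⟩
    exact ⟨g, hsub g hg, hne g hg, rfl⟩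
  · rintro _ ⟨f, hf, hf0, rfl⟩
    obtain ⟨g, hg, hle⟩ := hdeg f hf hf0
    exact Ideal.mem_of_dvd _ (initialMonomial_dvd_of_degree_le hle)
      (Ideal.subset_span ⟨g, hg, rfl⟩)

end GroebnerBasis

end DetGroebner

/-- The binomials `F_{I,J}` form a universal Gröbner basis of the ideal of `2`-minors of the
generic `m × n` matrix over a field `K`. -/
theorem theorem5p3 (K : Type*) [Field K] (m n : ℕ) :
    DetGroebner.IsUniversalGroebnerBasis
      (DetGroebner.cycleBinomials K m n)
      (DetGroebner.determinantalIdeal 2 (Matrix.mvPolynomialX (Fin m) (Fin n) K)) := by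
  intro ord
  refine DetGroebner.isGroebnerBasis_of_exists_degree_le DetGroebner.cycleBinomials_finite ?_ ?_ ?_
  all_goals simp only [DetGroebner.cycleBinomials_eq_range, Set.forall_mem_range,
    Set.exists_range_iff]
  · exact DetGroebner.cycleBinomial_mem_determinantalIdeal
  · exact DetGroebner.cycleBinomial_ne_zero
  · exact fun f hf hf0 => DetGroebner.exists_degree_cycleBinomial_le_degree ord hf0 hf
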